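/- Let $\Omega\subset\mathbb R^d$ be a bounded domain (open and connected) with $C^1$ boundary, let $\nu>0$, and let $u$ be a time-independent vector field, smooth on $\overline\Omega$, that is incompressible ($\nabla\cdot u=0$ in $\Omega$) and tangential on $\partial\Omega$ ($u\cdot\hat n=0$ on $\partial\Omega$, where $\hat n$ is the outward unit normal). Let $\mu_0(\nu,u)$ be the principal eigenvalue of $-\nu\Delta+u\cdot\nabla$ on $\Omega$ with homogeneous Dirichlet boundary conditions, that is, the real number $\mu_0$ for which there is $\phi_0\in H^1_0(\Omega)$, positive in $\Omega$, with $-\nu\Delta\phi_0+u\cdot\nabla\phi_0=\mu_0\phi_0$ in the weak sense. Let $\tau_d$ be the dissipation time, $$\tau_d=\sup_{s\in\mathbb R}\ \inf\Bigl\{t-s \;:\; t\ge s \text{ and } \|\theta_s(t)\|_{L^2(\Omega)}\le \tfrac1e\|\theta_{s,0}\|_{L^2(\Omega)}\ \text{ for all }\theta_{s,0}\in L^2(\Omega)\Bigr\}\in[0,\infty],$$ where $\theta_s$ is the weak solution, in $C([s,\infty);L^2(\Omega))\cap L^2_{\rm loc}([s,\infty);H^1_0(\Omega))$, of $\partial_t\theta_s+u\cdot\nabla\theta_s-\nu\Delta\theta_s=0$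 in $\Omega$ for $t>s$ with $\theta_s=0$ on $\partial\Omega$ and $\theta_s(s)=\theta_{s,0}$. Then $$\frac{\mu_0(\nu,u)}{\nu}\ \ge\ \frac1{\nu\,\tau_d}.$$ (Here $1/0=\infty$ and $1/\infty=0$.) -/

import Mathlib

open MeasureTheory Set Filter Topology
open scoped ENNReal ContDiff

/-- Euclidean space `ℝᵈ`. -/
abbrev Euc (d : ℕ) : Type := EuclideanSpace ℝ (Fin d)

/-- Real-valued `L²(Ω)`. -/
abbrev L2 {d : ℕ} (Ω : Set (Euc d)) : Type := Lp ℝ 2 ((volume : Measure (Euc d)).restrict Ω)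

/-- Vector-valued `L²(Ω; ℝᵈ)`. -/
abbrev L2Vec {d : ℕ} (Ω : Set (Euc d)) : Type :=
  Lp (Euc d) 2 ((volume : Measure (Euc d)).restrict Ω)

/-- `ρ` is a `C¹` defining function of `Ω` near `p`: `Ω` is locally `{ρ < 0}` and the gradient
of `ρ` does not vanish at `p`. -/
def IsLocalDefiningFunction {d : ℕ} (Ω : Set (Euc d)) (p : Euc d) (ρ : Euc d → ℝ) : Prop :=
  ContDiffAt ℝ 1 ρ p ∧ gradient ρ p ≠ 0 ∧ ∀ᶠ x in 𝓝 p, (x ∈ Ω ↔ ρ x < 0)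

/-- `Ω` has a `C¹` boundary and lies locally on one side of it. -/
def HasC1Boundary {d : ℕ} (Ω : Set (Euc d)) : Prop :=
  ∀ p ∈ frontier Ω, ∃ ρ : Euc d → ℝ, IsLocalDefiningFunction Ω p ρ

/-- `n` is the outward pointing unit normal of `Ω` at the boundary point `p`. -/
def IsOutwardUnitNormal {d : ℕ} (Ω : Set (Euc d)) (p n : Euc d) : Prop :=
  p ∈ frontier Ω ∧ ∃ ρ : Euc d → ℝ, IsLocalDefiningFunction Ω p ρ ∧
    n = ‖gradient ρ p‖⁻¹ • gradient ρ p

/-- The vector field `u` is tangential on `∂Ω`, i.e. `u · n = 0` there. -/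
def IsTangential {d : ℕ} (Ω : Set (Euc d)) (u : Euc d → Euc d) : Prop :=
  ∀ p n : Euc d, IsOutwardUnitNormal Ω p n → inner ℝ (u p) n = 0

/-- The divergence of a vector field, i.e. the trace of its derivative. -/
noncomputable def divergence {d : ℕ} (u : Euc d → Euc d) (x : Euc d) : ℝ :=
  LinearMap.trace ℝ (Euc d) (fderiv ℝ u x).toLinearMap

/-- The pairs `(φ, ∇φ)`, as classes in `L²`, with `φ` smooth and compactly supported in `Ω`. -/
def testPairs {d : ℕ} (Ω : Set (Euc d)) : Set (L2 Ω × L2Vec Ω) :=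
  {w | ∃ φ : Euc d → ℝ, ContDiff ℝ ∞ φ ∧ HasCompactSupport φ ∧ tsupport φ ⊆ Ω ∧
    w.1 =ᵐ[(volume : Measure (Euc d)).restrict Ω] φ ∧
    w.2 =ᵐ[(volume : Measure (Euc d)).restrict Ω] gradient φ}

/-- The Sobolev space `H¹₀(Ω)`, the closure of the test functions in the `H¹` norm. An element
is recorded as the pair of the function and its weak gradient. -/
def H10 {d : ℕ} (Ω : Set (Euc d)) : Set (L2 Ω × L2Vec Ω) :=
  closure (testPairs Ω)

/-- The bilinear form of `-ν Δ + u · ∇` with Dirichlet boundary conditions: for a function with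
gradient `g` and a test function `v` with gradient `h` it is
`ν ∫ g · h + ∫ (u · g) v` over `Ω`. -/
noncomputable def dirichletForm {d : ℕ} (ν : ℝ) (Ω : Set (Euc d)) (u : Euc d → Euc d)
    (g : L2Vec Ω) (z : L2 Ω × L2Vec Ω) : ℝ :=
  ν * inner ℝ g z.2 + ∫ x in Ω, inner ℝ (u x) (g x) * z.1 x

/-- `μ` is the principal eigenvalue of `-ν Δ + u · ∇` on `Ω` with homogeneous Dirichlet boundary
conditions: the real eigenvalue that has a (weak) eigenfunction in `H¹₀(Ω)` positive in `Ω`. -/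
def IsPrincipalEigenvalue {d : ℕ} (ν : ℝ) (Ω : Set (Euc d)) (u : Euc d → Euc d) (μ : ℝ) : Prop :=
  ∃ w ∈ H10 Ω, (∀ᵐ x ∂((volume : Measure (Euc d)).restrict Ω), 0 < w.1 x) ∧
    ∀ z ∈ H10 Ω, dirichletForm ν Ω u w.2 z = μ * inner ℝ w.1 z.1

/-- `θ` is the (weak) solution on `[s, ∞)` of `∂ₜ θ + u(t) · ∇θ - ν Δ θ = 0` in `Ω` with
homogeneous Dirichlet boundary conditions and initial data `θ s`: it lies in
`C([s, ∞); L²) ∩ L²_loc([s, ∞); H¹₀)`, and the equation, integrated in time, holds against every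
function in `H¹₀(Ω)`. Values of `θ` before time `s` play no role. -/
def IsSolution {d : ℕ} (ν : ℝ) (Ω : Set (Euc d)) (u : ℝ → Euc d → Euc d) (s : ℝ)
    (θ : ℝ → L2 Ω) : Prop :=
  ContinuousOn θ (Ici s) ∧
  ∃ G : ℝ → L2Vec Ω,
    (∀ᵐ t ∂((volume : Measure ℝ).restrict (Ioi s)), (θ t, G t) ∈ H10 Ω) ∧
    (∀ T : ℝ, MemLp G 2 ((volume : Measure ℝ).restrict (Ioc s T))) ∧
    ∀ z ∈ H10 Ω, ∀ t : ℝ, s ≤ t →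
      inner ℝ (θ t) z.1 - inner ℝ (θ s) z.1 + ∫ r in s..t, dirichletForm ν Ω (u r) (G r) z = 0

/-- The dissipation time of `u`: the supremum over the initial times `s` of the infimum of the
`t - s`, `t ≥ s`, such that every solution started at time `s` has lost the factor `e` in `L²` norm
at time `t`. It is `∞` if there is no such `t`. -/
noncomputable def dissipationTime {d : ℕ} (ν : ℝ) (Ω : Set (Euc d)) (u : ℝ → Euc d → Euc d) :
    ℝ≥0∞ :=
  ⨆ s : ℝ, sInf {τ : ℝ≥0∞ | ∃ t : ℝ, s ≤ t ∧ τ = ENNReal.ofReal (t - s) ∧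
    ∀ θ : ℝ → L2 Ω, IsSolution ν Ω u s θ → ‖θ t‖ ≤ ‖θ s‖ / Real.exp 1}

/-! The positive eigenfunction `w`, multiplied by `exp (-μ₀ (t - s))`, is itself a solution of the
evolution equation. A time `t` by which every solution has lost the factor `e` must work for this
one, which forces `1 ≤ μ₀ (t - s)`; hence `1 / μ₀ ≤ τ_d` when `μ₀ > 0`.

Only the sign of `μ₀` needs the incompressibility of `u`. Testing the eigenvalue equation with `w`
leaves `ν ‖∇w‖² = μ₀ ‖w‖²`, because the transport term is the integral of half the divergence of `w²
u`. That is checked on test functions and carried to `H10 Ω` by density. -/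

/-- The integral over the whole space of the divergence of a compactly supported `C¹` field
vanishes. -/
theorem integral_divergence_eq_zero {d : ℕ} {F : Euc d → Euc d} (hF : ContDiff ℝ 1 F)
    (hc : HasCompactSupport F) : ∫ x, divergence F x = 0 := by
  have hd : Continuous (fderiv ℝ F) := hF.continuous_fderiv one_ne_zero
  have hint (v : Euc d) : Integrable (fun x => fderiv ℝ F x v) :=
    (hd.clm_apply continuous_const).integrable_of_hasCompactSupport (hc.fderiv_apply ℝ v)
  have hzero (v : Euc d) : ∫ x, fderiv ℝ F x v = 0 := by
    -- Integration by parts against the constant function `1`.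
    have h := integral_smul_fderiv_eq_neg_fderiv_smul_of_integrable (μ := volume)
      (f := fun _ : Euc d => (1 : ℝ)) (g := F) (v := v) (by simp) (by simpa using hint v)
      (by simpa using hF.continuous.integrable_of_hasCompactSupport hc)
      (fun x _ => differentiableAt_const _) (fun x _ => hF.differentiable one_ne_zero x)
    simpa using h
  have hb := fun x =>
    (fderiv ℝ F x).toLinearMap.trace_eq_sum_inner (EuclideanSpace.basisFun (Fin d) ℝ)
  simp only [divergence, hb]
  rw [integral_finsetSum _ fun i _ => (hint _).const_inner _]
  refine Finset.sum_eq_zero fun i _ => ?_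
  have h := integral_inner (𝕜 := ℝ) (hint (EuclideanSpace.basisFun (Fin d) ℝ i))
    (EuclideanSpace.basisFun (Fin d) ℝ i)
  rw [hzero, inner_zero_right] at h
  exact h

theorem divergence_smul {d : ℕ} {f : Euc d → ℝ} {u : Euc d → Euc d} {x : Euc d}
    (hf : DifferentiableAt ℝ f x) (hu : DifferentiableAt ℝ u x) :
    divergence (fun y => f y • u y) x = f x * divergence u x + fderiv ℝ f x (u x) := by
  have h : (fderiv ℝ (fun y => f y • u y) x).toLinearMap =
      f x • (fderiv ℝ u x).toLinearMap + (fderiv ℝ f x).toLinearMap.smulRight (u x) := by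
    rw [fderiv_fun_smul hf hu]
    ext v : 1
    simp
  rw [divergence, h, map_add, map_smul, LinearMap.trace_smulRight]
  simp [divergence]

/-- Transport by a divergence free field is skew-symmetric on test functions. -/
theorem integral_inner_gradient_mul_self_eq_zero {d : ℕ} {Ω : Set (Euc d)} (hopen : IsOpen Ω)
    {u : Euc d → Euc d} (hu : ContDiffOn ℝ ∞ u Ω) (hdiv : ∀ x ∈ Ω, divergence u x = 0)
    {φ : Euc d → ℝ} (hφ : ContDiff ℝ ∞ φ) (hc : HasCompactSupport φ) (hs : tsupport φ ⊆ Ω) :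
    ∫ x in Ω, inner ℝ (u x) (gradient φ x) * φ x = 0 := by
  -- Since `u` is divergence free, `div (φ² u) = 2 φ (u · ∇φ)` in `Ω`. The support of `φ` lies
  -- inside `Ω`, so `F` is `C¹` on the whole space whatever `u` does outside `Ω`.
  set F : Euc d → Euc d := fun x => (φ x) ^ 2 • u x with hFdef
  have hsq : ContDiff ℝ ∞ fun x => (φ x) ^ 2 := hφ.pow 2
  have hFs : Function.support F ⊆ Function.support φ := by
    intro x hx h0
    exact hx (by simp [F, show φ x = 0 from h0])
  have hFt : tsupport F ⊆ tsupport φ := closure_mono hFs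
  have huAt {x : Euc d} (hx : x ∈ Ω) : ContDiffAt ℝ ∞ u x :=
    hu.contDiffAt (hopen.mem_nhds hx)
  have hzero {x : Euc d} (hx : x ∉ Ω) : F =ᶠ[𝓝 x] 0 :=
    notMem_tsupport_iff_eventuallyEq.mp fun h => hx (hs (hFt h))
  have hF : ContDiff ℝ 1 F := by
    rw [contDiff_iff_contDiffAt]
    intro x
    by_cases hx : x ∈ Ω
    · exact (hsq.contDiffAt.smul (huAt hx)).of_le (by exact_mod_cast le_top)
    · exact (contDiffAt_const (c := (0 : Euc d))).congr_of_eventuallyEq (hzero hx)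
  have hFc : HasCompactSupport F := hc.mono' (hFs.trans (subset_tsupport φ))
  have key := integral_divergence_eq_zero hF hFc
  have hout : ∀ x, x ∉ Ω → divergence F x = 0 := by
    intro x hx
    have h : fderiv ℝ F x = 0 := by
      rw [(hzero hx).fderiv_eq]
      exact fderiv_const_apply 0
    simp [divergence, h]
  rw [← setIntegral_eq_integral_of_forall_compl_eq_zero hout] at key
  have hin : ∀ x ∈ Ω, divergence F x = 2 * (inner ℝ (u x) (gradient φ x) * φ x) := by
    intro x hx
    have hd : DifferentiableAt ℝ φ x := hφ.differentiable (by simp) x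
    rw [hFdef, divergence_smul (hd.fun_pow 2) ((huAt hx).differentiableAt (by simp)), hdiv x hx,
      real_inner_comm, inner_gradient_left, fderiv_fun_pow 2 hd]
    simp
    ring
  rw [setIntegral_congr_fun hopen.measurableSet hin, integral_const_mul] at key
  simpa using key

/-- Pointwise inner product with a bounded field, as a bounded operator on `L²`. -/
theorem exists_transportOperator {d : ℕ} {Ω : Set (Euc d)} {u : Euc d → Euc d}
    (hu : AEStronglyMeasurable u (volume.restrict Ω)) {M : ℝ}
    (hM : ∀ᵐ x ∂((volume : Measure (Euc d)).restrict Ω), ‖u x‖ ≤ M) :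
    ∃ B : L2Vec Ω →L[ℝ] L2 Ω, ∀ g : L2Vec Ω,
      B g =ᵐ[(volume : Measure (Euc d)).restrict Ω] fun x => inner ℝ (u x) (g x) := by
  have hle (g : L2Vec Ω) : ∀ᵐ x ∂((volume : Measure (Euc d)).restrict Ω),
      ‖(inner ℝ (u x) (g x) : ℝ)‖ ≤ M * ‖g x‖ := by
    filter_upwards [hM] with x hx
    exact (norm_inner_le_norm _ _).trans (mul_le_mul_of_nonneg_right hx (norm_nonneg _))
  have hmem (g : L2Vec Ω) :
      MemLp (fun x => (inner ℝ (u x) (g x) : ℝ)) 2 ((volume : Measure (Euc d)).restrict Ω) :=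
    (Lp.memLp g).of_le_mul (hu.inner (Lp.aestronglyMeasurable g)) (hle g)
  let L : L2Vec Ω →ₗ[ℝ] L2 Ω :=
    { toFun := fun g => (hmem g).toLp _
      map_add' := by
        intro g h
        apply Lp.ext
        filter_upwards [(hmem (g + h)).coeFn_toLp, (hmem g).coeFn_toLp, (hmem h).coeFn_toLp,
          Lp.coeFn_add ((hmem g).toLp _) ((hmem h).toLp _), Lp.coeFn_add g h]
          with x h1 h2 h3 h4 h5
        rw [h1, h4, Pi.add_apply, h2, h3, h5, Pi.add_apply, inner_add_right]
      map_smul' := by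
        intro c g
        apply Lp.ext
        filter_upwards [(hmem (c • g)).coeFn_toLp, (hmem g).coeFn_toLp,
          Lp.coeFn_smul c ((hmem g).toLp _), Lp.coeFn_smul c g] with x h1 h2 h3 h4
        rw [RingHom.id_apply, h1, h3, Pi.smul_apply, h2, h4, Pi.smul_apply, inner_smul_right]
        rfl }
  refine ⟨L.mkContinuous M fun g => Lp.norm_le_mul_norm_of_ae_le_mul ?_, fun g =>
    (hmem g).coeFn_toLp⟩
  filter_upwards [hle g, (hmem g).coeFn_toLp] with x h1 h2
  change ‖((hmem g).toLp _ : L2 Ω) x‖ ≤ _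
  rw [h2]
  exact h1

/-- The Dirichlet form is coercive in the gradient: the transport term does not contribute. -/
theorem dirichletForm_self {d : ℕ} {Ω : Set (Euc d)} (hopen : IsOpen Ω)
    (hbdd : Bornology.IsBounded Ω) {u : Euc d → Euc d} (hsmooth : ContDiffOn ℝ ∞ u (closure Ω))
    (hdiv : ∀ x ∈ Ω, divergence u x = 0) (ν : ℝ) {z : L2 Ω × L2Vec Ω} (hz : z ∈ H10 Ω) :
    dirichletForm ν Ω u z.2 z = ν * ‖z.2‖ ^ 2 := by
  obtain ⟨M, hM⟩ := hbdd.isCompact_closure.exists_bound_of_continuousOn hsmooth.continuousOn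
  obtain ⟨B, hB⟩ := exists_transportOperator (Ω := Ω) (u := u) (M := M)
    ((hsmooth.continuousOn.mono subset_closure).aestronglyMeasurable hopen.measurableSet)
    ((ae_restrict_iff' hopen.measurableSet).mpr
      (Eventually.of_forall fun x hx => hM x (subset_closure hx)))
  have hform (w : L2 Ω × L2Vec Ω) :
      ∫ x in Ω, inner ℝ (u x) (w.2 x) * w.1 x = inner ℝ w.1 (B w.2) := by
    rw [L2.inner_def]
    refine integral_congr_ae ?_
    filter_upwards [hB w.2] with x hx
    simp [hx]
  -- Boundedness of `B` makes the transport term continuous in the pair, so its vanishing passes to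
  -- the closure.
  have hcl : IsClosed {w : L2 Ω × L2Vec Ω | inner ℝ w.1 (B w.2) = 0} :=
    isClosed_eq (continuous_fst.inner (B.continuous.comp continuous_snd)) continuous_const
  have hsub : testPairs Ω ⊆ {w : L2 Ω × L2Vec Ω | inner ℝ w.1 (B w.2) = 0} := by
    rintro w ⟨φ, hφ, hc, hs, h1, h2⟩
    rw [mem_ofPred_eq, ← hform, ← integral_inner_gradient_mul_self_eq_zero hopen
      (hsmooth.mono subset_closure) hdiv hφ hc hs]
    refine integral_congr_ae ?_
    filter_upwards [h1, h2] with x hx1 hx2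
    rw [hx1, hx2]
  have hz0 : inner ℝ z.1 (B z.2) = 0 := closure_minimal hsub hcl hz
  rw [dirichletForm, hform, hz0, real_inner_self_eq_norm_sq, add_zero]

theorem smul_mem_H10 {d : ℕ} {Ω : Set (Euc d)} (c : ℝ) {z : L2 Ω × L2Vec Ω} (hz : z ∈ H10 Ω) :
    c • z ∈ H10 Ω := by
  refine map_mem_closure (continuous_const_smul c) hz ?_
  rintro w ⟨φ, hφ, hc, hs, h1, h2⟩
  refine ⟨fun x => c * φ x, contDiff_const.mul hφ, hc.mul_left, ?_, ?_, ?_⟩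
  · exact (tsupport_mul_subset_right (f := fun _ => c) (g := φ)).trans hs
  · filter_upwards [h1, Lp.coeFn_smul c w.1] with x hx1 hx2
    rw [Prod.smul_fst, hx2, Pi.smul_apply, hx1, smul_eq_mul]
  · filter_upwards [h2, Lp.coeFn_smul c w.2] with x hx1 hx2
    rw [Prod.smul_snd, hx2, Pi.smul_apply, hx1, gradient, gradient,
      fderiv_const_mul (hφ.differentiable (by simp) x), map_smulₛₗ]
    simp

theorem dirichletForm_smul_left {d : ℕ} (ν : ℝ) (Ω : Set (Euc d)) (u : Euc d → Euc d) (c : ℝ)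
    (g : L2Vec Ω) (z : L2 Ω × L2Vec Ω) :
    dirichletForm ν Ω u (c • g) z = c * dirichletForm ν Ω u g z := by
  have h : ∫ x in Ω, inner ℝ (u x) ((c • g) x) * z.1 x =
      c * ∫ x in Ω, inner ℝ (u x) (g x) * z.1 x := by
    rw [← integral_const_mul]
    refine integral_congr_ae ?_
    filter_upwards [Lp.coeFn_smul c g] with x hx
    rw [hx, Pi.smul_apply, inner_smul_right, mul_assoc]
  rw [dirichletForm, dirichletForm, h, real_inner_smul_left]
  ring

/-- An eigenfunction, multiplied by the matching exponential in time, solves the evolution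
equation. -/
theorem isSolution_exp_smul_eigenfunction {d : ℕ} {ν : ℝ} {Ω : Set (Euc d)} {u : Euc d → Euc d}
    {μ : ℝ} {w : L2 Ω × L2Vec Ω} (hw : w ∈ H10 Ω)
    (heig : ∀ z ∈ H10 Ω, dirichletForm ν Ω u w.2 z = μ * inner ℝ w.1 z.1) (s : ℝ) :
    IsSolution ν Ω (fun _ => u) s fun t => Real.exp (-μ * (t - s)) • w.1 := by
  refine ⟨by fun_prop, fun t => Real.exp (-μ * (t - s)) • w.2, ?_, ?_, ?_⟩
  · exact Eventually.of_forall fun t => smul_mem_H10 (Real.exp (-μ * (t - s))) hw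
  · intro T
    have hcont : Continuous fun t : ℝ => Real.exp (-μ * (t - s)) • w.2 := by fun_prop
    obtain ⟨C, hC⟩ := (isCompact_Icc (a := s) (b := T)).exists_bound_of_continuousOn
      hcont.continuousOn
    exact MemLp.of_bound hcont.aestronglyMeasurable C
      ((ae_restrict_iff' measurableSet_Ioc).mpr
        (Eventually.of_forall fun x hx => hC x (Ioc_subset_Icc_self hx)))
  · intro z hz t _
    simp only [dirichletForm_smul_left, heig z hz, real_inner_smul_left]
    -- By the eigenvalue equation the integrand is an explicit exponential; its primitive is minus
    -- the pairing of the solution with `z`.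
    have hder : ∀ r ∈ uIcc s t, HasDerivAt
        (fun r => -(Real.exp (-μ * (r - s)) * inner ℝ w.1 z.1))
        (Real.exp (-μ * (r - s)) * (μ * inner ℝ w.1 z.1)) r := by
      intro r _
      refine ((((hasDerivAt_id' r).sub_const s).const_mul (-μ)).exp.mul_const
        (inner ℝ w.1 z.1)).fun_neg.congr_deriv ?_
      ring
    rw [intervalIntegral.integral_eq_sub_of_hasDerivAt hder
      (Continuous.intervalIntegrable (by fun_prop) _ _)]
    ring

/-- A nonempty open set has positive measure, so positivity almost everywhere is not vacuous. -/
theorem norm_pos_of_ae_pos {d : ℕ} {Ω : Set (Euc d)} (hopen : IsOpen Ω) (hne : Ω.Nonempty)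
    {f : L2 Ω} (hf : ∀ᵐ x ∂((volume : Measure (Euc d)).restrict Ω), 0 < f x) : 0 < ‖f‖ := by
  rw [norm_pos_iff]
  rintro rfl
  have hfalse : ∀ᵐ _ ∂((volume : Measure (Euc d)).restrict Ω), False := by
    filter_upwards [hf, Lp.coeFn_zero ℝ 2 ((volume : Measure (Euc d)).restrict Ω)] with x h1 h2
    rw [h2] at h1
    exact lt_irrefl _ h1
  rw [eventually_false_iff_eq_bot, ae_eq_bot, Measure.restrict_eq_zero] at hfalse
  exact (hopen.measure_pos volume hne).ne' hfalse

/-- Test the eigenvalue equation with the eigenfunction itself and use `dirichletForm_self`. -/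
theorem principalEigenvalue_nonneg {d : ℕ} {Ω : Set (Euc d)} (hopen : IsOpen Ω)
    (hne : Ω.Nonempty) (hbdd : Bornology.IsBounded Ω) {u : Euc d → Euc d}
    (hsmooth : ContDiffOn ℝ ∞ u (closure Ω)) (hdiv : ∀ x ∈ Ω, divergence u x = 0) {ν : ℝ}
    (hν : 0 ≤ ν) {μ : ℝ} (hμ : IsPrincipalEigenvalue ν Ω u μ) : 0 ≤ μ := by
  obtain ⟨w, hw, hpos, heig⟩ := hμ
  have h := heig w hw
  rw [dirichletForm_self hopen hbdd hsmooth hdiv ν hw, real_inner_self_eq_norm_sq] at h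
  exact nonneg_of_mul_nonneg_left (h ▸ by positivity)
    (pow_pos (norm_pos_of_ae_pos hopen hne hpos) 2)

/-- Any time at which every solution has lost a factor `e` is at least the inverse of the
principal eigenvalue. -/
theorem one_le_principalEigenvalue_mul {d : ℕ} {Ω : Set (Euc d)} (hopen : IsOpen Ω)
    (hne : Ω.Nonempty) {u : Euc d → Euc d} {ν μ : ℝ} (hμ : IsPrincipalEigenvalue ν Ω u μ)
    {s t : ℝ} (hdecay : ∀ θ : ℝ → L2 Ω, IsSolution ν Ω (fun _ => u) s θ →
      ‖θ t‖ ≤ ‖θ s‖ / Real.exp 1) : 1 ≤ μ * (t - s) := by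
  obtain ⟨w, hw, hpos, heig⟩ := hμ
  have hnorm := norm_pos_of_ae_pos hopen hne hpos
  have h := hdecay _ (isSolution_exp_smul_eigenfunction hw heig s)
  simp only [norm_smul, Real.norm_eq_abs, Real.abs_exp, sub_self, mul_zero, Real.exp_zero,
    abs_one, one_mul] at h
  -- Cancelling `‖w.1‖ > 0` leaves a comparison of the exponents `-μ (t - s)` and `-1`.
  rw [div_eq_inv_mul, mul_le_mul_iff_left₀ hnorm, ← Real.exp_neg, Real.exp_le_exp] at h
  linarith

/-- A rate that is at least `1 / τ` for every admissible decay time `τ` bounds the inverse of the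
dissipation time. -/
theorem ofReal_one_div_le_dissipationTime {d : ℕ} {ν μ : ℝ} {Ω : Set (Euc d)}
    {u : ℝ → Euc d → Euc d} {s : ℝ} (hμ : 0 < μ)
    (h : ∀ t, s ≤ t → (∀ θ : ℝ → L2 Ω, IsSolution ν Ω u s θ →
      ‖θ t‖ ≤ ‖θ s‖ / Real.exp 1) → 1 ≤ μ * (t - s)) :
    ENNReal.ofReal (1 / μ) ≤ dissipationTime ν Ω u := by
  refine le_iSup_of_le s (le_sInf ?_)
  rintro _ ⟨t, hst, rfl, ht⟩
  refine ENNReal.ofReal_le_ofReal ?_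
  rw [div_le_iff₀ hμ, mul_comm]
  exact h t hst ht

theorem propositionp {d : ℕ} (Ω : Set (Euc d))
    (hopen : IsOpen Ω) (hconn : IsConnected Ω) (hbdd : Bornology.IsBounded Ω)
    (hbdry : HasC1Boundary Ω)
    (u : Euc d → Euc d) (hsmooth : ContDiffOn ℝ ∞ u (closure Ω))
    (hdiv : ∀ x ∈ Ω, divergence u x = 0) (htan : IsTangential Ω u)
    (ν : ℝ) (hν : 0 < ν) (μ₀ : ℝ) (hμ₀ : IsPrincipalEigenvalue ν Ω u μ₀) :
    ((1 / (ENNReal.ofReal ν * dissipationTime ν Ω (fun _ => u)) : ℝ≥0∞) : EReal)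
      ≤ ((μ₀ / ν : ℝ) : EReal) := by
  have hdecay {s t : ℝ} := one_le_principalEigenvalue_mul (s := s) (t := t) hopen hconn.nonempty
    hμ₀
  have hnonneg := principalEigenvalue_nonneg hopen hconn.nonempty hbdd hsmooth hdiv hν.le hμ₀
  -- `ENNReal.ofReal` truncates negative numbers to zero, so this reduction relies on `0 ≤ μ₀`.
  suffices h : 1 / (ENNReal.ofReal ν * dissipationTime ν Ω (fun _ => u)) ≤
      ENNReal.ofReal (μ₀ / ν) by
    have h' := EReal.coe_ennreal_le_coe_ennreal_iff.mpr h
    rwa [EReal.coe_ennreal_ofReal, max_eq_left (by positivity)] at h'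
  rcases hnonneg.eq_or_lt with h0 | h0
  -- For `μ₀ = 0` no decay time is admissible: the infimum runs over the empty set, and both sides
  -- of the bound are zero.
  · have htop : dissipationTime ν Ω (fun _ => u) = ⊤ := by
      rw [eq_top_iff]
      refine le_iSup_of_le 0 (le_sInf ?_)
      rintro _ ⟨t, -, -, ht⟩
      have := hdecay ht
      rw [← h0] at this
      linarith
    rw [htop, ENNReal.mul_top (ENNReal.ofReal_pos.mpr hν).ne']
    simp
  · have hle := ofReal_one_div_le_dissipationTime (s := 0) h0 fun t _ => hdecay (t := t)
    calc 1 / (ENNReal.ofReal ν * dissipationTime ν Ω (fun _ => u))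
        ≤ 1 / (ENNReal.ofReal ν * ENNReal.ofReal (1 / μ₀)) := by gcongr
      _ = ENNReal.ofReal (μ₀ / ν) := by
        rw [← ENNReal.ofReal_mul hν.le, one_div, ← ENNReal.ofReal_inv_of_pos (by positivity)]
        congr 1
        field_simp
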